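/- Conventions. A 2-category is a $\mathbf{Cat}$-enriched category, where $\mathbf{Cat}$ is the 2-category of small categories; so hom-categories are small. Let $\mathscr A$ be a 2-category and $\lambda$ a regular cardinal. A $\lambda$-filtered colimit in $\mathscr A$ is a conical colimit of an ordinary functor $S:\mathscr J\to\mathscr A_0$ (with $\mathscr A_0$ the underlying ordinary category and $\mathscr J$ a small ordinary $\lambda$-filtered category), defined by an isomorphism of categories $\mathscr A(\operatorname{colim}S,B)\cong[\mathscr J,\mathscr A](S,\Delta B)$, natural in $B$. An object $X$ is $\lambda$-presentable if the 2-functor $\mathscr A(X,-):\mathscr A\to\mathbf{Cat}$ preserves $\lambda$-filtered colimits; $\mathscr A_\lambda$ denotes the full sub-2-category of $\lambda$-presentable objects. $\mathscr A$ is $\lambda$-accessible if it is the free completion under $\lambda$-filtered colimits of a small 2-category; explicitly, if it has $\lambda$-filtered colimits and is the closure under $\lambda$-filtered colimits of a small set of $\lambda$-presentable objects. $\mathscr A$ is accessible if it is $\lambda$-accessible for some regular $\lambda$. For 2-functors $F:\mathscr D\to\mathbf{Cat}$ and $S:\mathscr D\to\mathscr A$, the bilimit $\{F,S\}_b$ of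 $S$ weighted by $F$, if it exists, is an object of $\mathscr A$ with an equivalence $$\mathscr A(X,\{F,S\}_b)\simeq \mathrm{Ps}(\mathscr D,\mathbf{Cat})(F,\mathscr A(X,S-)),$$ pseudonatural in $X$, induced by a pseudonatural transformation $F\to\mathscr A(\{F,S\}_b,S-)$; here $\mathrm{Ps}(\mathscr D,\mathbf{Cat})(F,G)$ is the category of pseudonatural transformations $F\to G$ and modifications between them. $\mathscr A$ has bilimits if $\{F,S\}_b$ exists for all such $F$ and $S$ with $\mathscr D$ small. The bilimit of $S$ is the bilimit weighted by the constant 2-functor at the terminal category. An object $L$ of $\mathscr A$ is bi-initial if $\mathscr A(L,A)$ is equivalent to the terminal category for every object $A$ of $\mathscr A$. Lemma. Let $\mathscr A$ be an accessible 2-category with bilimits. Then $\mathscr A$ has a bi-initial object. Moreover, for every regular cardinal $\lambda$ for which $\mathscr A$ is $\lambda$-accessible, the inclusion $J:\mathscr A_\lambda\to\mathscr A$ has a bilimit, and every bilimit of $J$ is a bi-initial object of $\mathscr A$. -/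

import Mathlib

open CategoryTheory Bicategory Limits Opposite
open scoped Pseudofunctor.StrongTrans

universe w v u w₁ v₁ u₁

namespace TwoCat

section Representables

variable {B : Type u} [Bicategory.{w, v} B]

/-- The covariant representable `B(X, -) : B ⥤ᵖ Cat`. On 1-cells and 2-cells it is given by
postcomposition. -/
def coyoneda₀ (X : B) : B ⥤ᵖ Cat.{w, v} where
  obj Y := Cat.of (X ⟶ Y)
  map f := (postcomp X f).toCatHom
  map₂ α := NatTrans.toCatHom₂ ((postcomposing X _ _).map α)
  map₂_id f := by
    apply Cat.Hom₂.ext; ext x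
    exact Bicategory.whiskerLeft_id x f
  map₂_comp α β := by
    apply Cat.Hom₂.ext; ext x
    exact Bicategory.whiskerLeft_comp x α β
  mapId Y := rightUnitorNatIsoCat X Y
  mapComp f g := (associatorNatIsoLeftCat X f g).symm
  map₂_whisker_left {a b c} f {g h} η := by
    apply Cat.Hom₂.ext; ext (x : X ⟶ _)
    have : x ◁ f ◁ η = (α_ x f g).inv ≫ (x ≫ f) ◁ η ≫ (α_ x f h).hom := by simp
    exact this
  map₂_whisker_right {a b c f g} η h := by
    apply Cat.Hom₂.ext; ext (x : X ⟶ _)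
    have : x ◁ (η ▷ h) = (α_ x f h).inv ≫ (x ◁ η) ▷ h ≫ (α_ x g h).hom := by simp
    exact this
  map₂_associator f g h := by
    apply Cat.Hom₂.ext; ext (x : X ⟶ _)
    have : x ◁ (α_ f g h).hom = (α_ x (f ≫ g) h).inv ≫ (α_ x f g).inv ▷ h ≫
        𝟙 _ ≫ (α_ (x ≫ f) g h).hom ≫ (α_ x f (g ≫ h)).hom := by simp
    exact this
  map₂_left_unitor {a b} f := by
    apply Cat.Hom₂.ext; ext (x : X ⟶ _)
    have : x ◁ (λ_ f).hom = (α_ x (𝟙 a) f).inv ≫ (ρ_ x).hom ▷ f ≫ 𝟙 _ := by simp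
    exact this
  map₂_right_unitor {a b} f := by
    apply Cat.Hom₂.ext; ext (x : X ⟶ _)
    have : x ◁ (ρ_ f).hom = (α_ x f (𝟙 b)).inv ≫ (ρ_ (x ≫ f)).hom ≫ 𝟙 _ := by simp
    exact this

variable {D : Type u₁} [Bicategory.{w₁, v₁} D]

/-- The pseudofunctor `B(X, S-) : D ⥤ᵖ Cat`. -/
abbrev homInto (X : B) (S : D ⥤ᵖ B) : D ⥤ᵖ Cat.{w, v} := S.comp (coyoneda₀ X)

/-- The pseudonatural transformation `B(L, S-) ⟶ B(X, S-)` given by precomposition with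
`f : X ⟶ L`. -/
def precompTrans (S : D ⥤ᵖ B) {X L : B} (f : X ⟶ L) : homInto L S ⟶ homInto X S where
  app d := (precomp (S.obj d) f).toCatHom
  naturality g := (associatorNatIsoMiddleCat f (S.map g)).symm
  naturality_naturality {a b g h} η := by
    apply Cat.Hom₂.ext; ext (x : L ⟶ S.obj a)
    have : f ◁ x ◁ S.map₂ η ≫ (α_ f x (S.map h)).inv =
      (α_ f x (S.map g)).inv ≫ (f ≫ x) ◁ S.map₂ η := by simp
    exact this
  naturality_id a := by
    apply Cat.Hom₂.ext; ext (x : L ⟶ S.obj a)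
    have : (α_ f x (S.map (𝟙 a))).inv ≫ ((f ≫ x) ◁ (S.mapId a).hom ≫ (ρ_ (f ≫ x)).hom) =
      f ◁ (x ◁ (S.mapId a).hom ≫ (ρ_ x).hom) ≫ 𝟙 _ ≫ 𝟙 _ := by simp
    exact this
  naturality_comp {a b c} g h := by
    apply Cat.Hom₂.ext; ext (x : L ⟶ S.obj a)
    have : (α_ f x (S.map (g ≫ h))).inv ≫
          ((f ≫ x) ◁ (S.mapComp g h).hom ≫ (α_ (f ≫ x) (S.map g) (S.map h)).inv) =
        f ◁ (x ◁ (S.mapComp g h).hom ≫ (α_ x (S.map g) (S.map h)).inv) ≫ 𝟙 _ ≫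
          (α_ f (x ≫ S.map g) (S.map h)).inv ≫ 𝟙 _ ≫
          (α_ f x (S.map g)).inv ▷ S.map h ≫ 𝟙 _ := by simp
    exact this

/-- The modification `precompTrans S f ⟶ precompTrans S g` given by whiskering with a 2-cell
`α : f ⟶ g`. -/
def precompMod (S : D ⥤ᵖ B) {X L : B} {f g : X ⟶ L} (α : f ⟶ g) :
    precompTrans S f ⟶ precompTrans S g where
  as :=
    { app d := NatTrans.toCatHom₂ ((precomposing X L (S.obj d)).map α)
      naturality {a b} h := by
        apply Cat.Hom₂.ext; ext (x : L ⟶ S.obj a)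
        have : α ▷ (x ≫ S.map h) ≫ (α_ g x (S.map h)).inv =
          (α_ f x (S.map h)).inv ≫ (α ▷ x) ▷ S.map h := by simp
        exact this }

/-- A weighted cone `η : F ⟶ B(L, S-)` with vertex `L` induces, for every object `X`, the
functor `B(X, L) ⥤ Ps(D, Cat)(F, B(X, S-))` sending `f` to `η` followed by precomposition
with `f`. Here `Ps(D, Cat)(F, G)` is the category of pseudonatural transformations and
modifications. -/
def compareCone {F : D ⥤ᵖ Cat.{w, v}} {S : D ⥤ᵖ B} {L : B} (η : F ⟶ homInto L S) (X : B) :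
    (X ⟶ L) ⥤ (F ⟶ homInto X S) where
  obj f := η ≫ precompTrans S f
  map α := η ◁ precompMod S α
  map_id f := by
    have : precompMod S (𝟙 f) = 𝟙 (precompTrans S f) := by
      apply Pseudofunctor.StrongTrans.homCategory.ext
      intro d
      apply Cat.Hom₂.ext; ext (x : L ⟶ S.obj d)
      exact Bicategory.id_whiskerRight f x
    rw [this, Bicategory.whiskerLeft_id]
  map_comp α β := by
    have : precompMod S (α ≫ β) = precompMod S α ≫ precompMod S β := by
      apply Pseudofunctor.StrongTrans.homCategory.ext
      intro d
      apply Cat.Hom₂.ext; ext (x : L ⟶ S.obj d)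
      exact Bicategory.comp_whiskerRight α β x
    rw [this, Bicategory.whiskerLeft_comp]

/-- `η : F ⟶ B(L, S-)` exhibits `L` as the bilimit of `S` weighted by `F`: the induced functors
`B(X, L) ⥤ Ps(D, Cat)(F, B(X, S-))`, which are pseudonatural in `X`, are equivalences. -/
def IsBilimitCone {F : D ⥤ᵖ Cat.{w, v}} {S : D ⥤ᵖ B} {L : B} (η : F ⟶ homInto L S) : Prop :=
  ∀ X : B, (compareCone η X).IsEquivalence

/-- `L` is a bilimit of `S` weighted by `F`. -/
def IsWeightedBilimit (F : D ⥤ᵖ Cat.{w, v}) (S : D ⥤ᵖ B) (L : B) : Prop :=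
  ∃ η : F ⟶ homInto L S, IsBilimitCone η

/-- The weight constant at the terminal category. -/
def terminalWeight (D : Type u₁) [Bicategory.{w₁, v₁} D] : D ⥤ᵖ Cat.{w, w} where
  obj _ := Cat.of (Discrete PUnit.{w + 1})
  map _ := 𝟙 _
  map₂ _ := 𝟙 _
  mapId _ := Iso.refl _
  mapComp _ _ := (λ_ _).symm

/-- `L` is the (conical) bilimit of `S`, that is, its bilimit weighted by the terminal weight. -/
def IsConicalBilimit {B : Type u} [Bicategory.{w, w} B] (S : D ⥤ᵖ B) (L : B) : Prop :=
  IsWeightedBilimit (terminalWeight D) S L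

/-- An object is bi-initial if all hom-categories out of it are equivalent to the terminal
category. -/
def IsBiInitial (L : B) : Prop :=
  ∀ X : B, Nonempty ((L ⟶ X) ≌ Discrete PUnit.{1})

end Representables

section Accessible

variable {A : Type u} [Bicategory.{w, v} A] [Strict A]

theorem strict_whiskerRight_id {X Y : A} {x y : X ⟶ Y} (α : x ⟶ y) :
    α ▷ 𝟙 Y = eqToHom (Strict.comp_id x) ≫ α ≫ eqToHom (Strict.comp_id y).symm := by
  rw [Bicategory.whiskerRight_id, Strict.rightUnitor_eqToIso, Strict.rightUnitor_eqToIso]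
  simp

theorem strict_whiskerRight_comp {X Y Z W : A} {x y : X ⟶ Y} (α : x ⟶ y) (f : Y ⟶ Z)
    (g : Z ⟶ W) :
    α ▷ (f ≫ g) = eqToHom (Strict.assoc x f g).symm ≫ (α ▷ f) ▷ g ≫
      eqToHom (Strict.assoc y f g) := by
  rw [Bicategory.whiskerRight_comp, Strict.associator_eqToIso, Strict.associator_eqToIso]
  simp

theorem strict_id_whiskerLeft {X Y : A} {x y : X ⟶ Y} (α : x ⟶ y) :
    𝟙 X ◁ α = eqToHom (Strict.id_comp x) ≫ α ≫ eqToHom (Strict.id_comp y).symm := by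
  rw [Bicategory.id_whiskerLeft, Strict.leftUnitor_eqToIso, Strict.leftUnitor_eqToIso]
  simp

theorem strict_comp_whiskerLeft {X Y Z W : A} {x y : Z ⟶ W} (g : X ⟶ Y) (f : Y ⟶ Z)
    (α : x ⟶ y) :
    (g ≫ f) ◁ α = eqToHom (Strict.assoc g f x) ≫ g ◁ f ◁ α ≫
      eqToHom (Strict.assoc g f y).symm := by
  rw [Bicategory.comp_whiskerLeft, Strict.associator_eqToIso, Strict.associator_eqToIso]
  simp

/-- The covariant representable `A(X, -)` as an ordinary functor from the underlying category
of `A` to `Cat`. -/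
def homFrom (X : A) : A ⥤ Cat.{w, v} where
  obj Y := Cat.of (X ⟶ Y)
  map f := (postcomp X f).toCatHom
  map_id Y := by
    apply Cat.ext
    refine CategoryTheory.Functor.ext (fun x => Strict.comp_id x) (fun x y (α : x ⟶ y) => ?_)
    exact strict_whiskerRight_id α
  map_comp {Y Z W} f g := by
    apply Cat.ext
    refine CategoryTheory.Functor.ext (fun x => (Strict.assoc x f g).symm) (fun x y (α : x ⟶ y) => ?_)
    exact strict_whiskerRight_comp α f g

/-- The contravariant representable `A(-, Y)` as an ordinary functor from the opposite of the
underlying category of `A` to `Cat`. -/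
def homTo (Y : A) : Aᵒᵖ ⥤ Cat.{w, v} where
  obj X := Cat.of (X.unop ⟶ Y)
  map f := (precomp Y f.unop).toCatHom
  map_id X := by
    apply Cat.ext
    refine CategoryTheory.Functor.ext (fun x => Strict.id_comp x) (fun x y (α : x ⟶ y) => ?_)
    exact strict_id_whiskerLeft α
  map_comp {X Z W} f g := by
    apply Cat.ext
    refine CategoryTheory.Functor.ext (fun x => Strict.assoc g.unop f.unop x) (fun x y (α : x ⟶ y) => ?_)
    exact strict_comp_whiskerLeft g.unop f.unop α

/-- A cocone `c` on a diagram `F` of ordinary shape `J` in the 2-category `A` is a colimit in the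
2-categorical sense: for every object `Y` the canonical functor
`A(c.pt, Y) ⥤ lim_j A(F j, Y) = [J, A](F, Δ Y)` is an isomorphism of categories. -/
def IsColimit₂ {J : Type w₁} [Category.{v₁} J] {F : J ⥤ A} (c : Cocone F) : Prop :=
  ∀ Y : A, Nonempty (IsLimit ((homTo Y).mapCone c.op))

end Accessible

section Cardinal

variable (A : Type u) [Bicategory.{w, w} A] [Strict A] (κ : Cardinal.{w}) [Fact κ.IsRegular]

/-- `A` has (small, conical, 2-categorical) `κ`-filtered colimits. -/
def HasFilteredColimits₂ : Prop :=
  ∀ (J : Type w) [SmallCategory J] [IsCardinalFiltered J κ] (F : J ⥤ A),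
    ∃ c : Cocone F, IsColimit₂ c

variable {A}

/-- The object `X` is `κ`-presentable in the 2-category `A`: the 2-functor `A(X, -) : A ⥤ Cat`
preserves `κ`-filtered colimits. (In `Cat`, an ordinary conical colimit is automatically
2-categorical.) -/
def IsPresentable₂ (X : A) : Prop :=
  ∀ (J : Type w) [SmallCategory J] [IsCardinalFiltered J κ] (F : J ⥤ A) (c : Cocone F),
    IsColimit₂ c → Nonempty (IsColimit ((homFrom X).mapCocone c))

/-- The closure of a class of objects under `κ`-filtered colimits in `A`. -/
inductive FilteredClosure (P : A → Prop) : A → Prop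
  | of_mem (X : A) (hX : P X) : FilteredClosure P X
  | of_colimit (J : Type w) [SmallCategory J] [IsCardinalFiltered J κ] (F : J ⥤ A) (c : Cocone F)
      (hc : IsColimit₂ c) (hF : ∀ j, FilteredClosure P (F.obj j)) : FilteredClosure P c.pt

variable (A)

/-- The 2-category `A` is `κ`-accessible: it is the free completion under `κ`-filtered colimits of
a small 2-category, namely of its full sub-2-category on a small family `G` of objects. Explicitly,
`A` has `κ`-filtered colimits, every `G i` is `κ`-presentable, and `A` is the closure of
the family `G` under `κ`-filtered colimits. -/
def IsCardinalAccessible₂ : Prop :=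
  HasFilteredColimits₂ A κ ∧
    ∃ (ι : Type w) (G : ι → A), (∀ i, IsPresentable₂ κ (G i)) ∧
      ∀ X : A, FilteredClosure κ (fun Y => ∃ i, G i = Y) X

/-- The full sub-2-category `A_κ` of `A` on the `κ`-presentable objects. -/
abbrev PresentableObjects : Type u :=
  InducedBicategory A (Subtype.val : {X : A // IsPresentable₂ κ X} → A)

/-- The inclusion 2-functor `A_κ ⥤ A`. -/
abbrev presentableInclusion : StrictPseudofunctor (PresentableObjects A κ) A :=
  InducedBicategory.forget

end Cardinal

/-- The 2-category `A` is accessible if it is `κ`-accessible for some regular cardinal `κ`. -/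
def IsAccessible₂ (A : Type u) [Bicategory.{w, w} A] [Strict A] : Prop :=
  ∃ (κ : Cardinal.{w}) (_ : Fact κ.IsRegular), IsCardinalAccessible₂ A κ

/-- The 2-category `A` has bilimits: for every small 2-category `D` and all 2-functors
`F : D ⥤ Cat` and `S : D ⥤ A` there is a bilimit of `S` weighted by `F`. -/
def HasBilimits (A : Type u) [Bicategory.{w, w} A] : Prop :=
  ∀ (D : Type w) [Bicategory.{w, w} D] [Strict D] (F : StrictPseudofunctor D Cat.{w, w})
    (S : StrictPseudofunctor D A), ∃ L : A, IsWeightedBilimit F.toPseudofunctor S.toPseudofunctor L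

end TwoCat

/-! Let `G` be a small family of `κ`-presentable objects generating the 2-category under
`κ`-filtered colimits, and let `L`, with legs `p i`, be the bilimit of the full sub-2-category on
it. Induction on the closure shows that the slices of `G` over every `X` are filtered
(`FilteredClosure.filteredOver`); this rests on how objects and endomorphisms of a filtered colimit
in `Cat` arise from its stages. Take `h` from some `G i₀` to `L`. Restricting the bilimit cone along
`p i₀ ≫ h` returns the same cone up to isomorphism, so `p i₀ ≫ h ≅ 𝟙 L`. Hence 1-cells and 2-cells
out of `L` are controlled by their composites with `h`. By filteredness these are compared inside
the family, where the pseudocone identifies them (`IsConicalBilimit.isBiInitial`). The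
`κ`-presentable objects are not given as a small family, so the existence of their bilimit is proved
in the opposite direction: a bi-initial object receiving a map from a member of a family is the
bilimit of that family (`IsBiInitial.isConicalBilimit`). -/

namespace TwoCat

/-! ### Objects and morphisms of filtered colimits in `Cat` -/

section FilteredColimitCat

/-- The functor to the indiscrete category on `T` with the given action on objects. -/
def toIndiscrete {C T : Type w} [Category.{w} C] (f : C → T) :
    Cat.of C ⟶ Cat.of (ULiftHom.{w} (Codiscrete T)) :=
  (Codiscrete.functor f ⋙ ULiftHom.up).toCatHom

theorem toIndiscrete_obj_inj {C T : Type w} [Category.{w} C] {f g : C → T} {x y : C}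
    (h : (toIndiscrete f).toFunctor.obj x = (toIndiscrete g).toFunctor.obj y) : f x = g y :=
  congrArg (fun z => (ULiftHom.objDown.{w, w} z).as) h

variable {J : Type w} [SmallCategory J] {F : J ⥤ Cat.{w, w}} {c : Cocone F}

/-- Bundling morphisms as `Arrow`s lets them be compared across stages without transporting along
equalities of endpoints. -/
theorem cocone_mapArrow_obj (c : Cocone F) {j k : J} (f : j ⟶ k) (x : Arrow (F.obj j)) :
    (c.ι.app k).toFunctor.mapArrow.obj ((F.map f).toFunctor.mapArrow.obj x) =
      (c.ι.app j).toFunctor.mapArrow.obj x := by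
  rw [← c.w f]; rfl

/-- Functors into an indiscrete category are just functions on objects. Taking truth values as
objects, the predicate "comes from a stage" and the constant `True` agree on every stage, hence
agree on the colimit. -/
theorem exists_obj_of_isColimit (hc : IsColimit c) (x : c.pt) :
    ∃ (j : J) (y : F.obj j), (c.ι.app j).toFunctor.obj y = x := by
  let p : c.pt → ULift.{w} Prop := fun x =>
    ⟨∃ (j : J) (y : F.obj j), (c.ι.app j).toFunctor.obj y = x⟩
  have h : toIndiscrete p = toIndiscrete (fun _ => ⟨True⟩) := by
    refine hc.hom_ext fun j => ?_
    have : (fun y : F.obj j => p ((c.ι.app j).toFunctor.obj y)) = fun _ => ⟨True⟩ := by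
      funext y
      exact congrArg ULift.up (eq_true ⟨j, y, rfl⟩)
    exact congrArg toIndiscrete this
  have hx := toIndiscrete_obj_inj (congrArg (fun G => G.toFunctor.obj x) h)
  exact of_eq_true (congrArg ULift.down hx)

variable [IsFiltered J]

/-- The indiscrete category on the colimit of the object sets is the point of a cocone, so the
question reduces to filtered colimits of sets. -/
theorem exists_map_obj_eq_of_isColimit (hc : IsColimit c) {j : J} {x y : F.obj j}
    (h : (c.ι.app j).toFunctor.obj x = (c.ι.app j).toFunctor.obj y) :
    ∃ (k : J) (f : j ⟶ k), (F.map f).toFunctor.obj x = (F.map f).toFunctor.obj y := by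
  let G : J ⥤ Type w := F ⋙ Cat.objects
  let s : Cocone F :=
    { pt := Cat.of (ULiftHom.{w} (Codiscrete (colimit G)))
      ι :=
        { app i := toIndiscrete (fun a : F.obj i => colimit.ι G i a)
          naturality i k f := by
            have : (fun a : F.obj i => colimit.ι G k ((F.map f).toFunctor.obj a)) =
                fun a : F.obj i => colimit.ι G i a := by
              funext a
              exact ConcreteCategory.congr_hom (colimit.w G f) a
            exact congrArg toIndiscrete this } }
  have hs : ∀ a : F.obj j, (s.ι.app j).toFunctor.obj a =
      (hc.desc s).toFunctor.obj ((c.ι.app j).toFunctor.obj a) := fun a => by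
    rw [← hc.fac s j]; rfl
  have h' : (s.ι.app j).toFunctor.obj x = (s.ι.app j).toFunctor.obj y := by
    rw [hs, hs, h]
  have h'' : colimit.ι G j x = colimit.ι G j y := toIndiscrete_obj_inj h'
  -- The criterion for sets gives two possibly different maps `f` and `g` out of `j`; coequalizing
  -- them gives a single transition map.
  obtain ⟨k, f, g, hfg⟩ := (Types.FilteredColimit.colimit_eq_iff G).1 h''
  refine ⟨IsFiltered.coeq f g, f ≫ IsFiltered.coeqHom f g, ?_⟩
  have e := ConcreteCategory.congr_hom (congrArg G.map (IsFiltered.coeq_condition f g)) y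
  have e' := congrArg (G.map (IsFiltered.coeqHom f g)) hfg
  simp only [Functor.map_comp] at e
  have e3 := e'.trans e.symm
  simp only [Functor.map_comp]
  exact e3

theorem arrow_mk_comp_eq {C : Type*} [Category* C] {a b d x y z : C} {p : a ⟶ b} {q : b ⟶ d}
    {f : x ⟶ y} {g : y ⟶ z} (hf : Arrow.mk p = Arrow.mk f) (hg : Arrow.mk q = Arrow.mk g) :
    Arrow.mk (p ≫ q) = Arrow.mk (f ≫ g) := by
  cases hf; cases hg; rfl

theorem exists_mapArrow_obj_comp {C D : Type*} [Category* C] [Category* D] (G : C ⥤ D)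
    {b d : Arrow C} (h : b.right = d.left) {x y z : D} {f : x ⟶ y} {g : y ⟶ z}
    (hb : G.mapArrow.obj b = Arrow.mk f) (hd : G.mapArrow.obj d = Arrow.mk g) :
    ∃ e : Arrow C, G.mapArrow.obj e = Arrow.mk (f ≫ g) := by
  obtain ⟨b₁, b₂, p⟩ := b
  obtain ⟨d₁, d₂, q⟩ := d
  obtain rfl : b₂ = d₁ := h
  refine ⟨Arrow.mk ((show b₁ ⟶ b₂ from p) ≫ q), ?_⟩
  have := arrow_mk_comp_eq (p := G.map p) (q := G.map q) hb hd
  rw [← this]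
  simp

/-- The morphisms in the point of a cocone that come from some stage of the diagram. -/
def stageMorphisms (c : Cocone F) : MorphismProperty c.pt := fun _ _ f =>
  ∃ (j : J) (b : Arrow (F.obj j)), (c.ι.app j).toFunctor.mapArrow.obj b = Arrow.mk f

/-- To compose, move both arrows to a common stage. The middle objects may still differ there, but
they have the same image in the colimit and so coincide at a later stage. -/
theorem stageMorphisms_isMultiplicative (hc : IsColimit c) :
    (stageMorphisms c).IsMultiplicative where
  id_mem x := by
    obtain ⟨j, y, rfl⟩ := exists_obj_of_isColimit hc x
    exact ⟨j, Arrow.mk (𝟙 y), by simp⟩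
  comp_mem {x y z} f g := by
    rintro ⟨j, b, hb⟩ ⟨k, d, hd⟩
    have hb' := (cocone_mapArrow_obj c (IsFiltered.leftToMax j k) b).trans hb
    have hd' := (cocone_mapArrow_obj c (IsFiltered.rightToMax j k) d).trans hd
    obtain ⟨m, t, ht⟩ := exists_map_obj_eq_of_isColimit hc
      ((congrArg (fun a : Arrow c.pt => a.right) hb').trans
        (congrArg (fun a : Arrow c.pt => a.left) hd').symm)
    exact ⟨m, exists_mapArrow_obj_comp (c.ι.app m).toFunctor ht
      ((cocone_mapArrow_obj c t _).trans hb') ((cocone_mapArrow_obj c t _).trans hd')⟩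

theorem functor_ext_wideSubcategory {C D : Type*} [Category* C] [Category* D]
    {P : MorphismProperty D} [P.IsMultiplicative] {G H : C ⥤ WideSubcategory P}
    (h : G ⋙ wideSubcategoryInclusion P = H ⋙ wideSubcategoryInclusion P) : G = H := by
  refine CategoryTheory.Functor.ext (fun x => WideSubcategory.ext (congrArg (fun K => K.obj x) h))
    fun x y f => (wideSubcategoryInclusion P).map_injective ?_
  simp only [Functor.map_comp, eqToHom_map]
  exact Functor.congr_hom h f

/-- The cocone factors through the wide subcategory of stage morphisms. The induced functor followed
by the inclusion is the identity, so that subcategory contains every morphism. -/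
theorem stageMorphisms_of_isColimit (hc : IsColimit c) {x y : c.pt} (f : x ⟶ y) :
    stageMorphisms c f := by
  have := stageMorphisms_isMultiplicative hc
  let s : Cocone F :=
    { pt := Cat.of (WideSubcategory (stageMorphisms c))
      ι :=
        { app i := Functor.toCatHom
            { obj a := ⟨(c.ι.app i).toFunctor.obj a⟩
              map {a b} m := ⟨(c.ι.app i).toFunctor.map m, i, Arrow.mk m, rfl⟩
              map_id a := WideSubcategory.hom_ext _ (by simp)
              map_comp m n := WideSubcategory.hom_ext _ (by simp) }
          naturality i k t := by
            exact Cat.ext (functor_ext_wideSubcategory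
              (congrArg Cat.Hom.toFunctor (c.ι.naturality t))) } }
  have h : hc.desc s ≫ (wideSubcategoryInclusion (stageMorphisms c)).toCatHom = 𝟙 c.pt := by
    refine hc.hom_ext fun j => ?_
    exact (hc.fac_assoc s j _).trans (Category.comp_id (c.ι.app j)).symm
  have h₁ : Arrow.mk ((hc.desc s).toFunctor.map f).hom = Arrow.mk f :=
    congrArg (fun G : c.pt ⟶ c.pt => G.toFunctor.mapArrow.obj (Arrow.mk f)) h
  obtain ⟨j, b, hb⟩ := ((hc.desc s).toFunctor.map f).property
  exact ⟨j, b, hb.trans h₁⟩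

/-- A lift of `f` to a stage need not be an endomorphism, but its endpoints have the same image and
become equal later. -/
theorem exists_endomorphism_of_isColimit (hc : IsColimit c) {x : c.pt} (f : x ⟶ x) :
    ∃ (j : J) (y : F.obj j) (g : y ⟶ y),
      Arrow.mk ((c.ι.app j).toFunctor.map g) = Arrow.mk f := by
  obtain ⟨j, b, hb⟩ := stageMorphisms_of_isColimit hc f
  obtain ⟨k, t, ht⟩ := exists_map_obj_eq_of_isColimit hc
    ((congrArg (fun a : Arrow c.pt => a.left) hb).trans
      (congrArg (fun a : Arrow c.pt => a.right) hb).symm)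
  have hb' := (cocone_mapArrow_obj c t b).trans hb
  generalize hd : (F.map t).toFunctor.mapArrow.obj b = d at hb'
  have hlr : d.left = d.right := by rw [← hd]; exact ht
  clear hd
  obtain ⟨d₁, d₂, g⟩ := d
  obtain rfl : d₁ = d₂ := hlr
  exact ⟨k, d₁, g, hb'⟩

end FilteredColimitCat

/-! ### Filtered slices from closure under filtered colimits -/

/-- Bicategorical filteredness of the slices of a family of objects `F` over `X`: the family maps
to `X`, any two maps from the family to `X` factor through a common member of the family, and
endomorphisms of such a map come from endomorphisms of a map within the family. -/
structure FilteredOver {A : Type u} [Bicategory.{w, v} A] {ι : Type u₁} (F : ι → A) (X : A) :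
    Prop where
  nonempty : ∃ i, Nonempty (F i ⟶ X)
  exists_factor {i j : ι} (x : F i ⟶ X) (y : F j ⟶ X) :
    ∃ (k : ι) (r : F k ⟶ X) (a : F i ⟶ F k) (b : F j ⟶ F k),
      Nonempty (a ≫ r ≅ x) ∧ Nonempty (b ≫ r ≅ y)
  exists_endomorphism {i : ι} {x : F i ⟶ X} (β : x ⟶ x) :
    ∃ (k : ι) (r : F k ⟶ X) (a : F i ⟶ F k) (γ : a ⟶ a) (e : a ≫ r ≅ x),
      β = e.inv ≫ γ ▷ r ≫ e.hom

section Closure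

variable {A : Type u} [Bicategory.{w, w} A] [Strict A] {κ : Cardinal.{w}} [Fact κ.IsRegular]

theorem FilteredClosure.nonempty {P : A → Prop} {X : A} (hX : FilteredClosure κ P X) :
    ∃ Y, P Y ∧ Nonempty (Y ⟶ X) := by
  induction hX with
  | of_mem X hX => exact ⟨X, hX, ⟨𝟙 X⟩⟩
  | of_colimit J F c hc hF ih =>
    have := isFiltered_of_isCardinalFiltered J κ
    obtain ⟨j⟩ := IsFiltered.nonempty (C := J)
    obtain ⟨Y, hY, ⟨f⟩⟩ := ih j
    exact ⟨Y, hY, ⟨f ≫ c.ι.app j⟩⟩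

theorem IsPresentable₂.exists_comp_eq {Y : A} (hY : IsPresentable₂ κ Y) {J : Type w}
    [SmallCategory J] [IsCardinalFiltered J κ] {F : J ⥤ A} {c : Cocone F} (hc : IsColimit₂ c)
    (x : Y ⟶ c.pt) : ∃ (j : J) (y : Y ⟶ F.obj j), y ≫ c.ι.app j = x :=
  exists_obj_of_isColimit (hY J F c hc).some x

/-- In the inductive step presentability lifts both maps to stages, and the induction hypothesis
applies at a common later stage. Only the sources `Y` and `Z` need be presentable, not the objects
of the diagram. -/
theorem FilteredClosure.exists_factor {P : A → Prop} {X : A} (hX : FilteredClosure κ P X)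
    {Y Z : A} (hY : IsPresentable₂ κ Y) (hZ : IsPresentable₂ κ Z) (x : Y ⟶ X) (y : Z ⟶ X) :
    ∃ (W : A) (r : W ⟶ X) (a : Y ⟶ W) (b : Z ⟶ W), P W ∧ a ≫ r = x ∧ b ≫ r = y := by
  induction hX with
  | of_mem X hX => exact ⟨X, 𝟙 X, x, y, hX, Strict.comp_id x, Strict.comp_id y⟩
  | of_colimit J F c hc hF ih =>
    have := isFiltered_of_isCardinalFiltered J κ
    obtain ⟨j, x', hx⟩ := hY.exists_comp_eq hc x
    obtain ⟨k, y', hy⟩ := hZ.exists_comp_eq hc y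
    obtain ⟨W, r, a, b, hW, ha, hb⟩ := ih (IsFiltered.max j k)
      (x' ≫ F.map (IsFiltered.leftToMax j k)) (y' ≫ F.map (IsFiltered.rightToMax j k))
    refine ⟨W, r ≫ c.ι.app _, a, b, hW, ?_, ?_⟩
    · rw [← Strict.assoc, ha, Strict.assoc, c.w, hx]
    · rw [← Strict.assoc, hb, Strict.assoc, c.w, hy]

theorem arrow_whiskerRight_eq {X Y Z : A} {f g : X ⟶ Y} {f' g' : X ⟶ Y} {α : f ⟶ g}
    {β : f' ⟶ g'} (h : Arrow.mk α = Arrow.mk β) (r : Y ⟶ Z) :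
    Arrow.mk (α ▷ r) = Arrow.mk (β ▷ r) := by
  cases h; rfl

theorem FilteredClosure.exists_endomorphism {P : A → Prop} {X : A} (hX : FilteredClosure κ P X)
    {Y : A} (hY : IsPresentable₂ κ Y) {x : Y ⟶ X} (β : x ⟶ x) :
    ∃ (W : A) (r : W ⟶ X) (a : Y ⟶ W) (γ : a ⟶ a), P W ∧ Arrow.mk (γ ▷ r) = Arrow.mk β := by
  induction hX with
  | of_mem X hX =>
    refine ⟨X, 𝟙 X, x, β, hX, ?_⟩
    exact Arrow.ext (Strict.comp_id x) (Strict.comp_id x) (strict_whiskerRight_id β)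
  | of_colimit J F c hc hF ih =>
    have := isFiltered_of_isCardinalFiltered J κ
    obtain ⟨hcY⟩ := hY J F c hc
    obtain ⟨j, x', β', h⟩ := exists_endomorphism_of_isColimit hcY β
    obtain ⟨W, r, a, γ, hW, hγ⟩ := ih j (x := x') β'
    refine ⟨W, r ≫ c.ι.app j, a, γ, hW, Eq.trans ?_ ((arrow_whiskerRight_eq hγ _).trans h)⟩
    exact Arrow.ext (Strict.assoc _ _ _).symm (Strict.assoc _ _ _).symm
      (strict_whiskerRight_comp γ r _)

theorem exists_iso_of_arrow_eq {C : Type*} [Category* C] {x y : C} {f : x ⟶ x} {g : y ⟶ y}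
    (h : Arrow.mk f = Arrow.mk g) : ∃ e : x ≅ y, g = e.inv ≫ f ≫ e.hom := by
  cases h
  exact ⟨Iso.refl x, by simp⟩

/-- Allowing any family of presentables that contains the generators covers both the generators
themselves and the family of all presentables. -/
theorem FilteredClosure.filteredOver {ι κ' : Type*} {G : ι → A} {F : κ' → A} {X : A}
    (hX : FilteredClosure κ (fun Y => ∃ i, G i = Y) X) (hGF : ∀ i, ∃ k, F k = G i)
    (hF : ∀ k, IsPresentable₂ κ (F k)) : FilteredOver F X where
  nonempty := by
    obtain ⟨_, ⟨i, rfl⟩, h⟩ := hX.nonempty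
    obtain ⟨k, hk⟩ := hGF i
    exact ⟨k, hk ▸ h⟩
  exists_factor {i j} x y := by
    obtain ⟨_, r, a, b, ⟨l, rfl⟩, ha, hb⟩ := hX.exists_factor (hF i) (hF j) x y
    obtain ⟨k, hk⟩ := hGF l
    revert r a b
    rw [← hk]
    intro r a b ha hb
    exact ⟨k, r, a, b, ⟨eqToIso ha⟩, ⟨eqToIso hb⟩⟩
  exists_endomorphism {i x} β := by
    obtain ⟨_, r, a, γ, ⟨l, rfl⟩, h⟩ := hX.exists_endomorphism (hF i) β
    obtain ⟨k, hk⟩ := hGF l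
    revert r a γ
    rw [← hk]
    intro r a γ h
    obtain ⟨e, he⟩ := exists_iso_of_arrow_eq h
    exact ⟨k, r, a, γ, e, he⟩

end Closure

end TwoCat

namespace TwoCat

/-! ### Pseudocones and restriction of cones -/

section Pseudocone

variable {A : Type u} [Bicategory.{w, w} A] {ι : Type u₁} (F : ι → A)

/-- The inclusion in `A` of the full sub-bicategory on a family of objects. -/
abbrev familyInclusion : InducedBicategory A F ⥤ᵖ A :=
  (InducedBicategory.forget : StrictPseudofunctor (InducedBicategory A F) A).toPseudofunctor

/-- A pseudocone with vertex `X` over the full sub-bicategory of `A` on a family `F` of objects. -/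
structure Pseudocone (X : A) where
  app (i : ι) : X ⟶ F i
  iso {i j : ι} (g : F i ⟶ F j) : app j ≅ app i ≫ g
  iso_naturality {i j : ι} {g h : F i ⟶ F j} (α : g ⟶ h) :
    (iso g).hom ≫ app i ◁ α = (iso h).hom
  iso_id (i : ι) : (iso (𝟙 (F i))).hom = (ρ_ (app i)).inv
  iso_comp {i j k : ι} (g : F i ⟶ F j) (h : F j ⟶ F k) :
    (iso (g ≫ h)).hom = (iso h).hom ≫ (iso g).hom ▷ h ≫ (α_ (app i) g h).hom

variable {F} {X : A}

/-- The legs of a pseudonatural transformation out of the terminal weight. -/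
def transApp (η : terminalWeight (InducedBicategory A F) ⟶ homInto X (familyInclusion F)) (i : ι) :
    X ⟶ F i :=
  (η.app i).toFunctor.obj ⟨⟨⟩⟩

/-- The coherence isomorphisms of a pseudonatural transformation out of the terminal weight. -/
def transIso (η : terminalWeight (InducedBicategory A F) ⟶ homInto X (familyInclusion F)) {i j : ι}
    (g : F i ⟶ F j) : transApp η j ≅ transApp η i ≫ g :=
  (Cat.Hom.toNatIso (η.naturality (InducedBicategory.mkHom g))).app ⟨⟨⟩⟩

theorem trans_map_id (η : terminalWeight (InducedBicategory A F) ⟶ homInto X (familyInclusion F))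
    (i : ι) : (η.app i).toFunctor.map (𝟙 ⟨⟨⟩⟩) = 𝟙 (transApp η i) :=
  (η.app i).toFunctor.map_id _

/-- The pseudocone underlying a pseudonatural transformation out of the terminal weight. -/
def Pseudocone.ofTrans
    (η : terminalWeight (InducedBicategory A F) ⟶ homInto X (familyInclusion F)) :
    Pseudocone F X where
  app := transApp η
  iso := transIso η
  iso_naturality {i j g h} α := by
    have h₁ : (η.app j).toFunctor.map (𝟙 ⟨⟨⟩⟩) ≫ (transIso η h).hom =
        (transIso η g).hom ≫ transApp η i ◁ α :=
      congrArg (fun t => t.toNatTrans.app ⟨⟨⟩⟩)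
        (η.naturality_naturality (InducedBicategory.mkHom₂ α))
    have h₂ := (congrArg (· ≫ (transIso η h).hom) (trans_map_id η j)).symm.trans h₁
    exact h₂.symm.trans (Category.id_comp _)
  iso_id i := by
    have h₁ : (transIso η (𝟙 (F i))).hom ≫ transApp η i ◁ 𝟙 (𝟙 (F i)) ≫ (ρ_ (transApp η i)).hom =
        (η.app i).toFunctor.map (𝟙 ⟨⟨⟩⟩) ≫ 𝟙 (transApp η i) ≫ 𝟙 (transApp η i) :=
      congrArg (fun t => t.toNatTrans.app ⟨⟨⟩⟩) (η.naturality_id i)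
    have h₂ := h₁.trans (congrArg (· ≫ 𝟙 (transApp η i) ≫ 𝟙 (transApp η i)) (trans_map_id η i))
    have h₃ := h₂.trans (Category.id_comp (𝟙 (transApp η i) ≫ 𝟙 (transApp η i)))
    simp only [Bicategory.whiskerLeft_id, Category.id_comp] at h₃
    rw [← cancel_mono (ρ_ (transApp η i)).hom, h₃]
    simp
  iso_comp {i j k} g h := by
    have h₁ : (transIso η (g ≫ h)).hom ≫ transApp η i ◁ 𝟙 (g ≫ h) ≫ (α_ (transApp η i) g h).inv =
        (η.app k).toFunctor.map (𝟙 ⟨⟨⟩⟩) ≫ 𝟙 (transApp η k) ≫ (transIso η h).hom ≫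
          𝟙 (transApp η j ≫ h) ≫ (transIso η g).hom ▷ h ≫ 𝟙 ((transApp η i ≫ g) ≫ h) :=
      congrArg (fun t => t.toNatTrans.app ⟨⟨⟩⟩)
        (η.naturality_comp (InducedBicategory.mkHom g) (InducedBicategory.mkHom h))
    have h₂ := h₁.trans (congrArg (· ≫ 𝟙 (transApp η k) ≫ (transIso η h).hom ≫
          𝟙 (transApp η j ≫ h) ≫ (transIso η g).hom ▷ h ≫ 𝟙 ((transApp η i ≫ g) ≫ h))
          (trans_map_id η k))
    have h₃ := h₂.trans (Category.id_comp (𝟙 (transApp η k) ≫ (transIso η h).hom ≫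
          𝟙 (transApp η j ≫ h) ≫ (transIso η g).hom ▷ h ≫ 𝟙 ((transApp η i ≫ g) ≫ h)))
    simp only [Bicategory.whiskerLeft_id, Category.id_comp, Category.comp_id] at h₃
    rw [← cancel_mono (α_ (transApp η i) g h).inv, h₃]
    simp

/-- The pseudonatural transformation out of the terminal weight given by a pseudocone. -/
def Pseudocone.toTrans (p : Pseudocone F X) :
    terminalWeight (InducedBicategory A F) ⟶ homInto X (familyInclusion F) where
  app i := (Functor.fromPUnit (p.app i)).toCatHom
  naturality g := Cat.Hom.isoMk (NatIso.ofComponents (fun _ => p.iso g.hom) (by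
    rintro ⟨⟨⟩⟩ ⟨⟨⟩⟩ f
    have : 𝟙 _ ≫ (p.iso g.hom).hom = (p.iso g.hom).hom ≫ 𝟙 _ ▷ g.hom := by simp
    exact this))
  naturality_naturality {a b g h} α := by
    apply Cat.Hom₂.ext; ext x
    have : 𝟙 _ ≫ (p.iso h.hom).hom = (p.iso g.hom).hom ≫ p.app a ◁ α.hom := by
      rw [p.iso_naturality α.hom, Category.id_comp]
    exact this
  naturality_id a := by
    apply Cat.Hom₂.ext; ext x
    have : (p.iso (𝟙 (F a))).hom ≫ p.app a ◁ 𝟙 (𝟙 (F a)) ≫ (ρ_ (p.app a)).hom =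
        𝟙 _ ≫ 𝟙 _ ≫ 𝟙 _ := by
      have h := p.iso_id a
      simp only [Bicategory.whiskerLeft_id, Category.id_comp]
      exact (congrArg (· ≫ (ρ_ (p.app a)).hom) h).trans (by simp)
    exact this
  naturality_comp {a b c} g h := by
    apply Cat.Hom₂.ext; ext x
    have : (p.iso (g.hom ≫ h.hom)).hom ≫ p.app a ◁ 𝟙 (g.hom ≫ h.hom) ≫
          (α_ (p.app a) g.hom h.hom).inv =
        𝟙 _ ≫ 𝟙 _ ≫ (p.iso h.hom).hom ≫ 𝟙 _ ≫ (p.iso g.hom).hom ▷ h.hom ≫ 𝟙 _ := by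
      have e := p.iso_comp g.hom h.hom
      simp only [Bicategory.whiskerLeft_id, Category.id_comp, Category.comp_id]
      exact (congrArg (· ≫ (α_ (p.app a) g.hom h.hom).inv) e).trans (by simp)
    exact this

/-- Isomorphism of transformations out of the terminal weight from isomorphisms of legs. -/
def transIsoMk {η θ : terminalWeight (InducedBicategory A F) ⟶ homInto X (familyInclusion F)}
    (e : ∀ i, transApp η i ≅ transApp θ i)
    (he : ∀ {i j : ι} (g : F i ⟶ F j),
      (e j).hom ≫ (transIso θ g).hom = (transIso η g).hom ≫ (e i).hom ▷ g) : η ≅ θ :=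
  Pseudofunctor.StrongTrans.isoMk
    (fun i => Cat.Hom.isoMk (NatIso.ofComponents (F := (η.app i).toFunctor)
      (G := (θ.app i).toFunctor) (fun _ => e i) (by
        rintro ⟨⟨⟩⟩ ⟨⟨⟩⟩ f
        have h₁ := congrArg (· ≫ (e i).hom) (trans_map_id η i)
        have h₂ := congrArg ((e i).hom ≫ ·) (trans_map_id θ i)
        exact h₁.trans (((Category.id_comp _).trans (Category.comp_id _).symm).trans h₂.symm))))
    (fun {i j} g => by
      apply Cat.Hom₂.ext; ext ⟨⟨⟩⟩
      exact he g.hom)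

theorem transIso_compareCone_hom {L : A}
    (η : terminalWeight (InducedBicategory A F) ⟶ homInto L (familyInclusion F)) (f : X ⟶ L)
    {i j : ι} (g : F i ⟶ F j) : (transIso ((compareCone η X).obj f) g).hom =
      f ◁ (transIso η g).hom ≫ (α_ f (transApp η i) g).inv := by
  have : (transIso ((compareCone η X).obj f) g).hom =
      𝟙 _ ≫ f ◁ (transIso η g).hom ≫ 𝟙 _ ≫ (α_ f (transApp η i) g).inv ≫ 𝟙 _ := rfl
  rw [this]
  simp
  rfl

/-- The components of a modification of transformations out of the terminal weight. -/
def modApp {η θ : terminalWeight (InducedBicategory A F) ⟶ homInto X (familyInclusion F)}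
    (m : η ⟶ θ) (i : ι) : transApp η i ⟶ transApp θ i :=
  (m.as.app i).toNatTrans.app ⟨⟨⟩⟩

theorem modApp_naturality
    {η θ : terminalWeight (InducedBicategory A F) ⟶ homInto X (familyInclusion F)}
    (m : η ⟶ θ) {i j : ι} (g : F i ⟶ F j) :
    modApp m j ≫ (transIso θ g).hom = (transIso η g).hom ≫ modApp m i ▷ g :=
  congrArg (fun t => t.toNatTrans.app ⟨⟨⟩⟩) (m.as.naturality (InducedBicategory.mkHom g))

theorem mod_ext {η θ : terminalWeight (InducedBicategory A F) ⟶ homInto X (familyInclusion F)}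
    {m n : η ⟶ θ} (h : ∀ i, modApp m i = modApp n i) : m = n := by
  apply Pseudofunctor.StrongTrans.homCategory.ext
  intro i
  apply Cat.Hom₂.ext; ext ⟨⟨⟩⟩
  exact h i

/-- Since the sub-bicategory is full, `h ≫ c.app i` is one of its 1-cells, so `p` supplies
isomorphisms from the legs of `c` restricted along `p.app i₀ ≫ h` to those of `p`. They form a
modification by the axioms of `p` applied to the 2-cell `h ◁ c.iso g`. -/
theorem Pseudocone.iso_factor_naturality {L : A} (p : Pseudocone F X) (c : Pseudocone F L)
    {i₀ : ι} (h : F i₀ ⟶ L) {i j : ι} (g : F i ⟶ F j) :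
    ((α_ (p.app i₀) h (c.app j)).hom ≫ (p.iso (h ≫ c.app j)).inv) ≫ (p.iso g).hom =
      ((p.app i₀ ≫ h) ◁ (c.iso g).hom ≫ (α_ (p.app i₀ ≫ h) (c.app i) g).inv) ≫
        ((α_ (p.app i₀) h (c.app i)).hom ≫ (p.iso (h ≫ c.app i)).inv) ▷ g := by
  have h₁ := p.iso_naturality (h ◁ (c.iso g).hom ≫ (α_ h (c.app i) g).inv)
  rw [p.iso_comp, ← Iso.eq_inv_comp] at h₁
  have h₂ : (p.iso g).hom = (p.iso (h ≫ c.app j)).hom ≫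
      p.app i₀ ◁ (h ◁ (c.iso g).hom ≫ (α_ h (c.app i) g).inv) ≫
        (α_ (p.app i₀) (h ≫ c.app i) g).inv ≫ (p.iso (h ≫ c.app i)).inv ▷ g := by
    rw [h₁]
    simp
  rw [h₂]
  simp

/-- The cone `η` restricted along `transApp q i₀ ≫ h` is isomorphic to `q`. -/
def compareConeObjIso {L : A}
    (η : terminalWeight (InducedBicategory A F) ⟶ homInto L (familyInclusion F))
    (q : terminalWeight (InducedBicategory A F) ⟶ homInto X (familyInclusion F))
    {i₀ : ι} (h : F i₀ ⟶ L) : (compareCone η X).obj (transApp q i₀ ≫ h) ≅ q :=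
  transIsoMk (fun i => α_ (transApp q i₀) h (transApp η i) ≪≫ (transIso q (h ≫ transApp η i)).symm)
    (fun g => (Pseudocone.ofTrans q).iso_factor_naturality (Pseudocone.ofTrans η) h g |>.trans
      (congrArg (· ≫ _) (transIso_compareCone_hom η _ g).symm))

/-- Restricting a cone along the identity does nothing up to isomorphism. -/
def compareConeObjId {L : A}
    (η : terminalWeight (InducedBicategory A F) ⟶ homInto L (familyInclusion F)) :
    (compareCone η L).obj (𝟙 L) ≅ η :=
  transIsoMk (fun i => λ_ (transApp η i)) (fun {i j} g => by
    have : (λ_ (transApp η j)).hom ≫ (transIso η g).hom =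
        (𝟙 L ◁ (transIso η g).hom ≫ (α_ (𝟙 L) (transApp η i) g).inv) ≫
          (λ_ (transApp η i)).hom ▷ g := by simp
    exact this.trans (congrArg (· ≫ _) (transIso_compareCone_hom η _ g).symm))

end Pseudocone

/-! ### Bi-initial objects versus bilimits of families -/

section BiInitial

variable {A : Type u} [Bicategory.{w, w} A]

theorem isBiInitial_of_unique {L : A} (h₁ : ∀ X : A, Nonempty (L ⟶ X))
    (h₂ : ∀ (X : A) (f g : L ⟶ X), Nonempty (f ≅ g))
    (h₃ : ∀ (X : A) (f : L ⟶ X) (α : f ⟶ f), α = 𝟙 f) : IsBiInitial L := by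
  intro X
  let G : (L ⟶ X) ⥤ Discrete PUnit.{1} := Functor.star _
  have : G.Faithful := ⟨fun {f g α β} _ => by
    obtain ⟨i⟩ := h₂ X f g
    rw [← cancel_mono i.inv, h₃ X f (α ≫ i.inv), h₃ X f (β ≫ i.inv)]⟩
  have : G.Full := ⟨fun {f g} _ => ⟨(h₂ X f g).some.hom, Subsingleton.elim _ _⟩⟩
  have : G.EssSurj := ⟨fun _ => ⟨(h₁ X).some, ⟨eqToIso (Subsingleton.elim _ _)⟩⟩⟩
  have : G.IsEquivalence := {}
  exact ⟨G.asEquivalence⟩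

theorem IsBiInitial.nonempty {L : A} (hL : IsBiInitial L) (X : A) : Nonempty (L ⟶ X) :=
  ⟨(hL X).some.inverse.obj ⟨⟨⟩⟩⟩

theorem IsBiInitial.nonempty_iso {L : A} (hL : IsBiInitial L) {X : A} (f g : L ⟶ X) :
    Nonempty (f ≅ g) :=
  ⟨(hL X).some.functor.preimageIso (eqToIso (Subsingleton.elim _ _))⟩

theorem IsBiInitial.hom_ext {L : A} (hL : IsBiInitial L) {X : A} {f g : L ⟶ X} (α β : f ⟶ g) :
    α = β :=
  (hL X).some.functor.map_injective (Subsingleton.elim _ _)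

/-- Conjugating by `θ` turns whiskering with `p ≫ h` into whiskering with `𝟙 L`, which is faithful.
-/
theorem hom_ext_of_whiskerLeft_retract {L P X : A} {p : L ⟶ P} {h : P ⟶ L} (θ : p ≫ h ≅ 𝟙 L)
    {f g : L ⟶ X} {α β : f ⟶ g} (H : p ◁ h ◁ α = p ◁ h ◁ β) : α = β := by
  have h₁ : (p ≫ h) ◁ α = (p ≫ h) ◁ β := by simp [H]
  have h₂ : 𝟙 L ◁ α = 𝟙 L ◁ β := by
    rw [← cancel_epi (θ.hom ▷ f), ← whisker_exchange, ← whisker_exchange, h₁]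
  simpa using h₂

theorem hom_ext_of_whiskerRight_retract {L P X : A} {p : L ⟶ P} {h : P ⟶ L} (θ : p ≫ h ≅ 𝟙 L)
    {f g : X ⟶ L} {α β : f ⟶ g} (H : α ▷ p = β ▷ p) : α = β := by
  have h₁ : α ▷ (p ≫ h) = β ▷ (p ≫ h) := by simp [H]
  have h₂ : α ▷ 𝟙 L = β ▷ 𝟙 L := by
    rw [← cancel_epi (f ◁ θ.hom), whisker_exchange, whisker_exchange, h₁]
  simpa using h₂

variable {ι : Type u₁} {F : ι → A} {L : A}

/-- If every slice of the family is filtered, then the bilimit of the family is bi-initial. -/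
theorem IsConicalBilimit.isBiInitial (hF : ∀ X, FilteredOver F X)
    (hL : IsConicalBilimit (familyInclusion F) L) : IsBiInitial L := by
  obtain ⟨η, hη⟩ := hL
  obtain ⟨i₀, ⟨h⟩⟩ := (hF L).nonempty
  have := hη L
  let p := Pseudocone.ofTrans η
  -- Both 1-cells restrict `η` to a cone isomorphic to `η`, and `compareCone η L` is fully faithful.
  let θ : p.app i₀ ≫ h ≅ 𝟙 L :=
    (compareCone η L).preimageIso (compareConeObjIso η η h ≪≫ (compareConeObjId η).symm)
  refine isBiInitial_of_unique (fun X => ?_) (fun X f g => ?_) (fun X _ α => ?_)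
  · obtain ⟨i, ⟨x⟩⟩ := (hF X).nonempty
    exact ⟨p.app i ≫ x⟩
  · obtain ⟨k, r, a, b, ⟨ea⟩, ⟨eb⟩⟩ := (hF X).exists_factor (h ≫ f) (h ≫ g)
    -- The comparison 1-cell `p.app k ≫ r` does not depend on `f` or `a`, so it links `f` and `g`.
    have key : ∀ (f : L ⟶ X) (a : F i₀ ⟶ F k), (a ≫ r ≅ h ≫ f) → Nonempty (p.app k ≫ r ≅ f) :=
      fun f a e => ⟨whiskerRightIso (p.iso a) r ≪≫ α_ _ _ _ ≪≫ whiskerLeftIso _ e ≪≫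
        (α_ _ _ _).symm ≪≫ whiskerRightIso θ f ≪≫ λ_ f⟩
    obtain ⟨e₁⟩ := key f a ea
    obtain ⟨e₂⟩ := key g b eb
    exact ⟨e₁.symm ≪≫ e₂⟩
  · obtain ⟨k, r, a, γ, e, hβ⟩ := (hF X).exists_endomorphism (h ◁ α)
    -- Naturality of the pseudocone at an endo-2-cell of `a`, with the invertible `p.iso a`
    -- cancelled.
    have hγ : p.app i₀ ◁ γ = 𝟙 _ := by
      rw [← cancel_epi (p.iso a).hom, p.iso_naturality γ, Category.comp_id]
    apply hom_ext_of_whiskerLeft_retract θ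
    have hγr : p.app i₀ ◁ γ ▷ r = 𝟙 _ := by
      rw [← cancel_epi (α_ (p.app i₀) a r).hom, ← associator_naturality_middle, hγ]
      simp
    rw [hβ, Bicategory.whiskerLeft_comp, Bicategory.whiskerLeft_comp, hγr]
    simp

/-- A pseudocone with bi-initial vertex over any family. -/
noncomputable def IsBiInitial.pseudocone (hL : IsBiInitial L) (F : ι → A) : Pseudocone F L where
  app i := (hL.nonempty (F i)).some
  iso _ := (hL.nonempty_iso _ _).some
  iso_naturality _ := hL.hom_ext _ _
  iso_id _ := hL.hom_ext _ _
  iso_comp _ _ := hL.hom_ext _ _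

/-- A bi-initial object receiving a map from a member of a family is the bilimit of the full
sub-bicategory on that family. -/
theorem IsBiInitial.isConicalBilimit (hL : IsBiInitial L) {i₀ : ι} (h : F i₀ ⟶ L) :
    IsConicalBilimit (familyInclusion F) L := by
  let c := hL.pseudocone F
  refine ⟨c.toTrans, fun X => ?_⟩
  let θ : c.app i₀ ≫ h ≅ 𝟙 L := (hL.nonempty_iso _ _).some
  have : (compareCone c.toTrans X).Faithful := ⟨fun {f g α β} H => by
    exact hom_ext_of_whiskerRight_retract θ (congrArg (fun m => modApp m i₀) H)⟩
  have : (compareCone c.toTrans X).EssSurj := ⟨fun q => ⟨_, ⟨compareConeObjIso c.toTrans q h⟩⟩⟩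
  have : (compareCone c.toTrans X).Full := ⟨fun {f g} m => by
    let m₀ : f ≫ c.app i₀ ⟶ g ≫ c.app i₀ := modApp m i₀
    -- The preimage is forced: conjugate `m₀ ▷ h` by `θ`. It then remains to check every other
    -- component.
    refine ⟨(ρ_ f).inv ≫ f ◁ θ.inv ≫ (α_ f (c.app i₀) h).inv ≫ m₀ ▷ h ≫
      (α_ g (c.app i₀) h).hom ≫ g ◁ θ.hom ≫ (ρ_ g).hom, mod_ext fun i => ?_⟩
    let mi : f ≫ c.app i ⟶ g ≫ c.app i := modApp m i
    let t := c.iso (h ≫ c.app i)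
    -- Parallel 2-cells out of a bi-initial object are equal, so the coherence cell `t` can be
    -- rewritten through `θ`.
    have ht : t.hom = (λ_ (c.app i)).inv ≫ θ.inv ▷ c.app i ≫ (α_ (c.app i₀) h (c.app i)).hom :=
      hL.hom_ext _ _
    have ht' : t.inv = (α_ (c.app i₀) h (c.app i)).inv ≫ θ.hom ▷ c.app i ≫ (λ_ (c.app i)).hom :=
      hL.hom_ext _ _
    -- Naturality of `m` at `h ≫ c.app i`, a 1-cell of the family, determines `mi` from `m₀`.
    have hm : mi ≫ g ◁ t.hom ≫ (α_ g (c.app i₀) (h ≫ c.app i)).inv =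
        (f ◁ t.hom ≫ (α_ f (c.app i₀) (h ≫ c.app i)).inv) ≫ m₀ ▷ (h ≫ c.app i) := by
      have h₁ := modApp_naturality m (h ≫ c.app i)
      rw [transIso_compareCone_hom, transIso_compareCone_hom] at h₁
      exact h₁
    have hm' : mi = f ◁ t.hom ≫ (α_ f (c.app i₀) (h ≫ c.app i)).inv ≫ m₀ ▷ (h ≫ c.app i) ≫
        (α_ g (c.app i₀) (h ≫ c.app i)).hom ≫ g ◁ t.inv := by
      rw [← cancel_mono (g ◁ t.hom ≫ (α_ g (c.app i₀) (h ≫ c.app i)).inv), hm]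
      simp
    refine Eq.trans ?_ hm'.symm
    change _ ▷ c.app i = _
    rw [ht, ht']
    bicategory⟩
  exact {}

end BiInitial

end TwoCat

/-! ### Application to generators and to presentable objects -/

namespace TwoCat

/-- The weight constant at the terminal category, as a strict pseudofunctor. -/
def strictTerminalWeight (D : Type u₁) [Bicategory.{w₁, v₁} D] :
    StrictPseudofunctor D Cat.{w, w} where
  __ := terminalWeight D
  map_id _ := rfl
  mapId_eq_eqToIso _ := rfl
  map_comp _ _ := (Strict.id_comp _).symm
  mapComp_eq_eqToIso _ _ := by
    change (λ_ _).symm = _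
    rw [Strict.leftUnitor_eqToIso]
    rfl

variable {A : Type u} [Bicategory.{w, w} A] [Strict A]

theorem HasBilimits.exists_isConicalBilimit (h : HasBilimits A) {ι : Type w} (F : ι → A) :
    ∃ L : A, IsConicalBilimit (familyInclusion F) L :=
  h (InducedBicategory A F) (strictTerminalWeight _) InducedBicategory.forget

theorem IsCardinalAccessible₂.exists_isBiInitial {κ : Cardinal.{w}} [Fact κ.IsRegular]
    (h : IsCardinalAccessible₂ A κ) (hA : HasBilimits A) : ∃ L : A, IsBiInitial L := by
  obtain ⟨_, ι, G, hG, hX⟩ := h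
  obtain ⟨L, hL⟩ := hA.exists_isConicalBilimit G
  exact ⟨L, hL.isBiInitial fun X => (hX X).filteredOver (fun i => ⟨i, rfl⟩) hG⟩

theorem IsCardinalAccessible₂.filteredOver_presentable {κ : Cardinal.{w}} [Fact κ.IsRegular]
    (h : IsCardinalAccessible₂ A κ) (X : A) :
    FilteredOver (Subtype.val : {X : A // IsPresentable₂ κ X} → A) X := by
  obtain ⟨_, ι, G, hG, hX⟩ := h
  exact (hX X).filteredOver (fun i => ⟨⟨G i, hG i⟩, rfl⟩) (fun k => k.2)

end TwoCat

theorem mainTheorem7 {A : Type u} [Bicategory.{w, w} A] [Strict A]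
    (hacc : TwoCat.IsAccessible₂ A) (hbilim : TwoCat.HasBilimits A) :
    (∃ L : A, TwoCat.IsBiInitial L) ∧
      ∀ (κ : Cardinal.{w}) [Fact κ.IsRegular], TwoCat.IsCardinalAccessible₂ A κ →
        (∃ L : A, TwoCat.IsConicalBilimit
          (TwoCat.presentableInclusion A κ).toPseudofunctor L) ∧
        ∀ L : A, TwoCat.IsConicalBilimit
          (TwoCat.presentableInclusion A κ).toPseudofunctor L → TwoCat.IsBiInitial L := by
  obtain ⟨κ, hκ, h⟩ := hacc
  obtain ⟨L, hL⟩ := h.exists_isBiInitial hbilim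
  refine ⟨⟨L, hL⟩, fun κ _ h => ⟨?_, fun L' hL' => hL'.isBiInitial h.filteredOver_presentable⟩⟩
  -- `L` was built from generators for a possibly different cardinal; all that is needed here is a
  -- map to it from some presentable object for the present `κ`.
  obtain ⟨i, ⟨f⟩⟩ := (h.filteredOver_presentable L).nonempty
  exact ⟨L, hL.isConicalBilimit f⟩
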